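/- Let $A$ be a ring (associative with unit, not necessarily commutative); modules are left $A$-modules and noetherian means left noetherian. A \emph{perfect complex} over $A$ is a complex of $A$-modules that is quasi-isomorphic (that is, isomorphic in the derived category of $A$) to a finite complex $0\to P^a\to\dots\to P^b\to 0$ of finitely generated projective $A$-modules; the \emph{length} of such a finite complex is $b-a$. For an integer $r\ge 0$, the ring $A$ is called \emph{strongly $r$-regular} if every perfect complex over $A$ is quasi-isomorphic to a finite direct sum of finite complexes of finitely generated projective $A$-modules, each of length $\le r$. Let $r\ge 0$ and let $A$ be a noetherian strongly $r$-regular ring. Then the global dimension of $A$, i.e. the supremum of the projective dimensions of all $A$-modules, is at most $r$. If moreover $A$ is commutative, then $A$ is a regular ring (it is noetherian and its localization at every prime ideal is a regular local ring) and its Krull dimension is at most $r$. -/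

import Mathlib

open CategoryTheory CategoryTheory.Limits

universe u

namespace StrongReg

/-- Two complexes of left `A`-modules (cohomological grading by `ℤ`) are quasi-isomorphic if they
become isomorphic in the derived category of `A`, that is, in the localization of the category of
complexes with respect to the quasi-isomorphisms. -/
def QuasiIsomorphic {A : Type u} [Ring A] (K L : CochainComplex (ModuleCat.{u} A) ℤ) : Prop :=
  letI : HasDerivedCategory (ModuleCat.{u} A) := HasDerivedCategory.standard _
  Nonempty (DerivedCategory.Q.obj K ≅ DerivedCategory.Q.obj L)

/-- `K` is a complex `0 → K ^ a → ⋯ → K ^ b → 0` of finitely generated projective modules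
(all terms outside of the degrees `a, …, b` vanish). -/
structure IsFiniteProjectiveComplex {A : Type u} [Ring A]
    (K : CochainComplex (ModuleCat.{u} A) ℤ) (a b : ℤ) : Prop where
  isStrictlyGE : K.IsStrictlyGE a
  isStrictlyLE : K.IsStrictlyLE b
  finite : ∀ n : ℤ, Module.Finite A (K.X n)
  projective : ∀ n : ℤ, Module.Projective A (K.X n)

/-- A perfect complex: a complex of modules that is quasi-isomorphic to a finite complex of
finitely generated projective modules. -/
def IsPerfect {A : Type u} [Ring A] (K : CochainComplex (ModuleCat.{u} A) ℤ) : Prop :=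
  ∃ (L : CochainComplex (ModuleCat.{u} A) ℤ) (a b : ℤ),
    IsFiniteProjectiveComplex L a b ∧ QuasiIsomorphic K L

/-- `A` is strongly `r`-regular: every perfect complex is quasi-isomorphic to a (finite) direct sum
of complexes of finitely generated projective modules of length `b - a ≤ r`. The direct sum of
complexes is the coproduct `∐ F` in the category of complexes. -/
def IsStronglyRegular (A : Type u) [Ring A] (r : ℕ) : Prop :=
  ∀ K : CochainComplex (ModuleCat.{u} A) ℤ, IsPerfect K →
    ∃ (s : ℕ) (F : Fin s → CochainComplex (ModuleCat.{u} A) ℤ),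
      (∀ i, ∃ a b : ℤ, b - a ≤ r ∧ IsFiniteProjectiveComplex (F i) a b) ∧
        QuasiIsomorphic K (∐ F)

/-- The (left) global dimension of `A`: the supremum of the projective dimensions of all left
`A`-modules. -/
noncomputable def globalDimension (A : Type u) [Ring A] : WithBot ℕ∞ :=
  ⨆ M : ModuleCat.{u} A, projectiveDimension M

end StrongReg

/-! Resolve a finitely generated module `M` by finitely generated projectives and cut the resolution
after `r + 1` steps. This perfect complex has cohomology only in degree `0`, where it is `M`, and in
degree `-(r + 1)`. A summand of length at most `r` whose range contains `0` cannot reach degree `-(r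
+ 1)`, so it is exact outside degree `0`: its positive part splits off, and its negative part
resolves its `H^0` in at most `r` steps. As `M` is the sum of these `H^0`, its projective dimension
is at most `r` (`hasProjectiveDimensionLE_homology_zero`). Vanishing of `Ext^(r + 1)` on finitely
generated modules bounds all injective dimensions by Baer's criterion, hence all projective
dimensions.

In the commutative case, localizing `A ⧸ p` bounds the projective dimension of the residue field of
`A_p`, and Serre's theorem applies. For a local ring `R` with maximal ideal `m ≠ 0` and residue
field of finite projective dimension, prime avoidance gives a regular `x` in `m` outside `m ^ 2`.
Then `m / xR` is a direct summand of `m / xm`, so the hypothesis passes to `R / xR`, and induction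
on the dimension yields a regular sequence generating `m`. Its length is both `dim R` and the
projective dimension of the residue field. -/

namespace StrongReg

/-! ### Projective dimension of sums, kernels, images and quotients -/

section ProjectiveDimension

open Abelian

/-- If the identity of `X` is a finite sum of endomorphisms factoring through objects of projective
dimension `< n`, then `X` has projective dimension `< n`. -/
lemma hasProjectiveDimensionLT_of_sum_eq_id {C : Type*} [Category C] [Abelian C] {ι : Type*}
    [Fintype ι] {X : C} {Y : ι → C} (f : ∀ i, X ⟶ Y i) (g : ∀ i, Y i ⟶ X)
    (h : ∑ i, f i ≫ g i = 𝟙 X) (n : ℕ) (hY : ∀ i, HasProjectiveDimensionLT (Y i) n) :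
    HasProjectiveDimensionLT X n := by
  classical
  let := HasExt.standard C
  rw [hasProjectiveDimensionLT_iff]
  intro m hm T e
  -- Each summand acts on `e` through `Ext^m(Y i, T)`, which vanishes.
  have key : ∀ s : Finset ι, (Ext.mk₀ (∑ i ∈ s, f i ≫ g i)).comp e (zero_add m) = 0 := by
    intro s
    induction s using Finset.induction_on with
    | empty => simp
    | insert i s hi ih =>
      rw [Finset.sum_insert hi, Ext.mk₀_add, Ext.add_comp, ih, add_zero, ← Ext.mk₀_comp_mk₀,
        Ext.comp_assoc_of_second_deg_zero,
        ((Ext.mk₀ (g i)).comp e (zero_add m)).eq_zero_of_hasProjectiveDimensionLT n hm,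
        Ext.comp_zero]
  rw [← e.mk₀_id_comp, ← h, key]

variable {A : Type u} [Ring A]

lemma hasProjectiveDimensionLT_of_linearEquiv {M N : Type u} [AddCommGroup M] [Module A M]
    [AddCommGroup N] [Module A N] (e : M ≃ₗ[A] N) (n : ℕ)
    [HasProjectiveDimensionLT (ModuleCat.of A M) n] :
    HasProjectiveDimensionLT (ModuleCat.of A N) n :=
  hasProjectiveDimensionLT_of_iso e.toModuleIso n

lemma hasProjectiveDimensionLT_of_subsingleton (M : Type u) [AddCommGroup M] [Module A M]
    [Subsingleton M] (n : ℕ) : HasProjectiveDimensionLT (ModuleCat.of A M) n :=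
  have := (ModuleCat.isZero_of_subsingleton (ModuleCat.of A M)).hasProjectiveDimensionLT_zero
  hasProjectiveDimensionLT_of_ge _ 0 n (Nat.zero_le n)

lemma hasProjectiveDimensionLT_one_of_projective (M : Type u) [AddCommGroup M] [Module A M]
    [Module.Projective A M] : HasProjectiveDimensionLT (ModuleCat.of A M) 1 := by
  have : Projective (ModuleCat.of A M) := (IsProjective.iff_projective M).1 inferInstance
  infer_instance

lemma projective_of_hasProjectiveDimensionLT_one (M : Type u) [AddCommGroup M] [Module A M]
    [HasProjectiveDimensionLT (ModuleCat.of A M) 1] : Module.Projective A M := by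
  have := projective_iff_hasProjectiveDimensionLT_one.2
    (inferInstance : HasProjectiveDimensionLT (ModuleCat.of A M) 1)
  exact (IsProjective.iff_projective M).2 this

variable {M N : Type u} [AddCommGroup M] [Module A M] [AddCommGroup N] [Module A N]

lemma hasProjectiveDimensionLT_range [Module.Projective A M] (f : M →ₗ[A] N) (n : ℕ)
    [HasProjectiveDimensionLT (ModuleCat.of A (LinearMap.ker f)) n] :
    HasProjectiveDimensionLT (ModuleCat.of A (LinearMap.range f)) (n + 1) := by
  have hS := LinearMap.shortExact_shortComplexKer f.surjective_rangeRestrict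
  have := hasProjectiveDimensionLT_one_of_projective (A := A) M
  refine hS.hasProjectiveDimensionLT_X₃ n ?_ (hasProjectiveDimensionLT_of_ge _ 1 _ (by omega))
  exact hasProjectiveDimensionLT_of_linearEquiv
    (LinearEquiv.ofEq _ _ (LinearMap.ker_rangeRestrict f).symm) n

lemma projective_ker [Module.Projective A M] (f : M →ₗ[A] N)
    [Module.Projective A (LinearMap.range f)] : Module.Projective A (LinearMap.ker f) := by
  have hS := LinearMap.shortExact_shortComplexKer f.surjective_rangeRestrict
  have hM := hasProjectiveDimensionLT_one_of_projective (A := A) M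
  have := hasProjectiveDimensionLT_one_of_projective (A := A) (LinearMap.range f)
  have h : HasProjectiveDimensionLT (ModuleCat.of A (LinearMap.ker f.rangeRestrict)) 1 :=
    hS.hasProjectiveDimensionLT_X₁ 1 hM (hasProjectiveDimensionLT_of_ge _ 1 _ (by omega))
  have := hasProjectiveDimensionLT_of_linearEquiv
    (LinearEquiv.ofEq _ _ (LinearMap.ker_rangeRestrict f)) 1
  exact projective_of_hasProjectiveDimensionLT_one _

lemma hasProjectiveDimensionLT_quotient [Module.Projective A M] (N : Submodule A M) (n : ℕ)
    [HasProjectiveDimensionLT (ModuleCat.of A N) n] :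
    HasProjectiveDimensionLT (ModuleCat.of A (M ⧸ N)) (n + 1) := by
  have hS := LinearMap.shortExact_shortComplexKer N.mkQ_surjective
  have := hasProjectiveDimensionLT_one_of_projective (A := A) M
  refine hS.hasProjectiveDimensionLT_X₃ n ?_ (hasProjectiveDimensionLT_of_ge _ 1 _ (by omega))
  exact hasProjectiveDimensionLT_of_linearEquiv (LinearEquiv.ofEq _ _ N.ker_mkQ.symm) n

end ProjectiveDimension

/-! ### Finite projective complexes exact outside degree `0` -/

section Complex

variable {A : Type u} [Ring A] (F : CochainComplex (ModuleCat.{u} A) ℤ)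

lemma range_d_eq_ker_d {i j k : ℤ} (hij : i + 1 = j) (hjk : j + 1 = k) (h : F.ExactAt j) :
    LinearMap.range (F.d i j).hom = LinearMap.ker (F.d j k).hom := by
  rw [F.exactAt_iff' i j k (by simp [← hij]) (by simp [hjk])] at h
  exact h.moduleCat_range_eq_ker

variable {F}

lemma IsFiniteProjectiveComplex.subsingleton_X {a b : ℤ} (hF : IsFiniteProjectiveComplex F a b)
    {j : ℤ} (hj : j < a ∨ b < j) : Subsingleton (F.X j) := by
  have := hF.isStrictlyGE
  have := hF.isStrictlyLE
  rw [← ModuleCat.isZero_iff_subsingleton]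
  exact hj.elim (fun h ↦ F.isZero_of_isStrictlyGE a j h) (fun h ↦ F.isZero_of_isStrictlyLE b j h)

lemma IsFiniteProjectiveComplex.exactAt {a b : ℤ} (hF : IsFiniteProjectiveComplex F a b)
    {j : ℤ} (hj : j < a ∨ b < j) : F.ExactAt j :=
  ShortComplex.exact_of_isZero_X₂ _ ((ModuleCat.isZero_iff_subsingleton).2 (hF.subsingleton_X hj))

/-- Descending induction from above `b`, where the terms vanish: by exactness the image of `d j` is
the next kernel, hence projective, so `d j` splits onto it. -/
lemma IsFiniteProjectiveComplex.projective_ker_d {a b : ℤ} (hF : IsFiniteProjectiveComplex F a b)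
    (h : ∀ j : ℤ, 0 < j → F.ExactAt j) (k : ℕ) (j : ℤ) (hj : 0 ≤ j) (hjk : b < j + k) :
    Module.Projective A (LinearMap.ker (F.d j (j + 1)).hom) := by
  induction k generalizing j with
  | zero =>
    have := hF.subsingleton_X (j := j) (Or.inr (by simpa using hjk))
    infer_instance
  | succ k ih =>
    have h1 := ih (j + 1) (by omega) (by push_cast at hjk; omega)
    rw [← range_d_eq_ker_d F rfl rfl (h (j + 1) (by omega))] at h1
    have := hF.projective j
    exact projective_ker _

/-- Below degree `0` the complex resolves its own kernels. The count starts with zero kernels for `j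
≤ a` (bound `< 0`), and each further degree adds one. -/
lemma IsFiniteProjectiveComplex.hasProjectiveDimensionLT_ker_d {a b : ℤ}
    (hF : IsFiniteProjectiveComplex F a b) (h : ∀ j : ℤ, j < 0 → F.ExactAt j) (k : ℕ) (j : ℤ)
    (hj : j < 0) (hjk : j ≤ a + k) :
    HasProjectiveDimensionLT (ModuleCat.of A (LinearMap.ker (F.d j (j + 1)).hom)) k := by
  induction k generalizing j with
  | zero =>
    obtain ⟨i, rfl⟩ : ∃ i, j = i + 1 := ⟨j - 1, by ring⟩
    have := hF.subsingleton_X (j := i) (Or.inl (by simp at hjk; omega))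
    rw [← range_d_eq_ker_d F rfl rfl (h (i + 1) hj)]
    have : Subsingleton (LinearMap.range (F.d i (i + 1)).hom) :=
      (LinearMap.surjective_rangeRestrict (F.d i (i + 1)).hom).subsingleton
    exact hasProjectiveDimensionLT_of_subsingleton _ 0
  | succ k ih =>
    obtain ⟨i, rfl⟩ : ∃ i, j = i + 1 := ⟨j - 1, by ring⟩
    have := ih i (by omega) (by push_cast at hjk; omega)
    rw [← range_d_eq_ker_d F rfl rfl (h (i + 1) hj)]
    have := hF.projective i
    exact hasProjectiveDimensionLT_range _ k

/-- `H^0` is the projective module `ker d^0` modulo the image of `d^(-1)`, and that image is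
resolved by the terms in negative degrees, of which at most `r` are nonzero. -/
lemma IsFiniteProjectiveComplex.hasProjectiveDimensionLE_homology_zero {a b : ℤ}
    (hF : IsFiniteProjectiveComplex F a b) (h : ∀ j : ℤ, j ≠ 0 → F.ExactAt j) (r : ℕ)
    (har : 0 ≤ a + r) : HasProjectiveDimensionLE (F.homology 0) r := by
  let S := F.sc' (-1) 0 1
  have hproj := fun j ↦ hF.projective j
  have : Module.Projective A (LinearMap.ker S.g.hom) :=
    hF.projective_ker_d (fun j hj ↦ h j hj.ne') (b + 1).toNat 0 le_rfl (by omega)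
  have hr : HasProjectiveDimensionLT
      (ModuleCat.of A (LinearMap.range S.moduleCatToCycles)) r := by
    obtain _ | r := r
    · have : Subsingleton S.X₁ := hF.subsingleton_X (j := -1) (Or.inl (by simp at har; omega))
      have : Subsingleton (LinearMap.range S.moduleCatToCycles) :=
        (LinearMap.surjective_rangeRestrict S.moduleCatToCycles).subsingleton
      exact hasProjectiveDimensionLT_of_subsingleton _ 0
    · have h1 := hF.hasProjectiveDimensionLT_ker_d (fun j hj ↦ h j hj.ne) r (-1) (by omega)
        (by push_cast at har; omega)
      have h2 : LinearMap.ker S.moduleCatToCycles = LinearMap.ker (F.d (-1) (-1 + 1)).hom :=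
        LinearMap.ker_codRestrict _ _ _
      have : Module.Projective A S.X₁ := hproj (-1)
      have : HasProjectiveDimensionLT
          (ModuleCat.of A (LinearMap.ker S.moduleCatToCycles)) r := by
        rwa [h2]
      exact hasProjectiveDimensionLT_range S.moduleCatToCycles r
  have : HasProjectiveDimensionLT S.moduleCatLeftHomologyData.H (r + 1) :=
    hasProjectiveDimensionLT_quotient _ r
  exact hasProjectiveDimensionLT_of_iso (S.moduleCatHomologyIso.symm ≪≫
    ShortComplex.homologyMapIso (F.isoSc' (-1) 0 1 (by simp) (by simp)).symm) (r + 1)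

end Complex

/-! ### Truncated resolutions as cochain complexes -/

section Resolution

variable {A : Type u} [Ring A]

/-- A finitely generated module over a noetherian ring has a resolution by finitely generated
projective modules truncated in degree `n`: it is exact except possibly in degree `n`. -/
lemma exists_truncated_resolution [IsNoetherianRing A] (n : ℕ) (M : ModuleCat.{u} A)
    [Module.Finite A M] :
    ∃ (P : ℕ → ModuleCat.{u} A) (d : ∀ k, P (k + 1) ⟶ P k) (π : P 0 ⟶ M),
      (∀ k, Module.Finite A (P k)) ∧ (∀ k, Module.Projective A (P k)) ∧
      (∀ k, n < k → Subsingleton (P k)) ∧ Function.Surjective π ∧ d 0 ≫ π = 0 ∧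
      (∀ k, d (k + 1) ≫ d k = 0) ∧
      (0 < n → LinearMap.ker π.hom ≤ LinearMap.range (d 0).hom) ∧
      (∀ k, k + 1 ≠ n → LinearMap.ker (d k).hom ≤ LinearMap.range (d (k + 1)).hom) := by
  induction n generalizing M with
  | zero =>
    obtain ⟨m, f, hf⟩ := Module.Finite.exists_fin' A M
    let P := Fin m → A
    refine ⟨fun k ↦ k.casesOn (ModuleCat.of A P) (fun _ ↦ ModuleCat.of A PUnit.{u + 1}), fun k ↦ 0,
      ModuleCat.ofHom f, ?_, ?_, ?_, hf, by simp, by simp, by simp, ?_⟩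
    · rintro (_ | k)
      · exact inferInstanceAs (Module.Finite A P)
      · exact inferInstanceAs (Module.Finite A PUnit.{u + 1})
    · rintro (_ | k)
      · exact inferInstanceAs (Module.Projective A P)
      · exact inferInstanceAs (Module.Projective A PUnit.{u + 1})
    · rintro (_ | k) hk
      · simp at hk
      · exact inferInstanceAs (Subsingleton PUnit.{u + 1})
    · rintro k - (x : PUnit.{u + 1}) -
      exact Submodule.zero_mem _
  | succ n ih =>
    obtain ⟨m, f, hf⟩ := Module.Finite.exists_fin' A M
    let P₀ := Fin m → A
    -- The kernel is finitely generated because `A` is noetherian.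
    obtain ⟨P, d, π, h1, h2, h3, h4, h5, h6, h7, h8⟩ := ih (ModuleCat.of A (LinearMap.ker f))
    refine ⟨fun k ↦ k.casesOn (ModuleCat.of A P₀) P, fun k ↦ k.casesOn
      (π ≫ ModuleCat.ofHom (LinearMap.ker f).subtype) d, ModuleCat.ofHom f, ?_, ?_, ?_, hf,
      ?_, ?_, ?_, ?_⟩
    · rintro (_ | k)
      · exact inferInstanceAs (Module.Finite A P₀)
      · exact h1 k
    · rintro (_ | k)
      · exact inferInstanceAs (Module.Projective A P₀)
      · exact h2 k
    · rintro (_ | k) hk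
      · simp at hk
      · exact h3 k (by omega)
    · ext x
      exact (π x).2
    · rintro (_ | k)
      · exact (Category.assoc _ _ _).symm.trans (by rw [h5, zero_comp])
      · exact h6 k
    · intro _ x hx
      obtain ⟨y, hy⟩ := h4 ⟨x, hx⟩
      exact ⟨y, congrArg Subtype.val hy⟩
    · rintro (_ | k) hk
      · intro x hx
        exact h7 (by omega) (Subtype.ext hx)
      · exact h8 k (by omega)

variable (P : ℕ → ModuleCat.{u} A) (d : ∀ k, P (k + 1) ⟶ P k) (hd : ∀ k, d (k + 1) ≫ d k = 0)

/-- The terms of the cochain complex with `P k` in degree `-k`. -/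
def negX : ℤ → ModuleCat.{u} A
  | Int.ofNat 0 => P 0
  | Int.ofNat (_ + 1) => ModuleCat.of A PUnit
  | Int.negSucc k => P (k + 1)

/-- The differentials of the cochain complex with `P k` in degree `-k`. -/
def negD : ∀ j : ℤ, negX P j ⟶ negX P (j + 1)
  | Int.ofNat _ => 0
  | Int.negSucc 0 => d 0
  | Int.negSucc (k + 1) => d (k + 1)

/-- The cochain complex with `P k` in degree `-k`. -/
noncomputable def negComplex : CochainComplex (ModuleCat.{u} A) ℤ :=
  CochainComplex.of (negX P) (negD P d) (by
    rintro (j | _ | _ | j)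
    · exact zero_comp
    · exact comp_zero
    · exact hd 0
    · exact hd (j + 1))

lemma negComplex_d_zero : (negComplex P d hd).d 0 1 = 0 :=
  CochainComplex.of_d (negX P) (negD P d) 0

lemma negComplex_d_negSucc_zero : (negComplex P d hd).d (-1) 0 = d 0 :=
  CochainComplex.of_d (negX P) (negD P d) (-1)

lemma negComplex_d_negSucc_succ (k : ℕ) :
    (negComplex P d hd).d (Int.negSucc (k + 1)) (Int.negSucc k) = d (k + 1) :=
  CochainComplex.of_d (negX P) (negD P d) (Int.negSucc (k + 1))

lemma exactAt_negComplex {n : ℕ}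
    (h : ∀ k, k + 1 ≠ n → LinearMap.ker (d k).hom ≤ LinearMap.range (d (k + 1)).hom)
    (j : ℤ) (hj : j ≠ 0) (hjn : j ≠ -n) : (negComplex P d hd).ExactAt j := by
  obtain (_ | j) | _ | j := j
  · exact (hj rfl).elim
  · refine ShortComplex.exact_of_isZero_X₂ _ ?_
    exact ModuleCat.isZero_of_subsingleton (ModuleCat.of A PUnit.{u + 1})
  · rw [HomologicalComplex.exactAt_iff' _ (Int.negSucc 1) (Int.negSucc 0) 0 (by simp)
      (by simp), ShortComplex.moduleCat_exact_iff_ker_sub_range]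
    have h1 := negComplex_d_negSucc_succ P d hd 0
    have h2 := negComplex_d_negSucc_zero P d hd
    have h3 := h 0 (by rintro rfl; exact hjn rfl)
    rw [← h1, ← h2] at h3
    exact h3
  · rw [HomologicalComplex.exactAt_iff' _ (Int.negSucc (j + 2)) (Int.negSucc (j + 1))
      (Int.negSucc j) (by simp) (by simp; rfl), ShortComplex.moduleCat_exact_iff_ker_sub_range]
    have h1 := negComplex_d_negSucc_succ P d hd j
    have h2 := negComplex_d_negSucc_succ P d hd (j + 1)
    have h3 := h (j + 1) (by rintro rfl; exact hjn rfl)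
    rw [← h1, ← h2] at h3
    exact h3

/-- Since the differential leaving degree `0` is zero, `H^0` is the cokernel of `d 0`, and by
exactness `π` is such a cokernel. -/
lemma nonempty_homology_negComplex_iso {M : ModuleCat.{u} A} (π : P 0 ⟶ M)
    (hπ : Function.Surjective π) (w : d 0 ≫ π = 0)
    (h : LinearMap.ker π.hom ≤ LinearMap.range (d 0).hom) :
    Nonempty ((negComplex P d hd).homology 0 ≅ M) := by
  let K := negComplex P d hd
  let S : ShortComplex (ModuleCat.{u} A) := ShortComplex.mk (K.d (-1) 0) π
    (by rw [negComplex_d_negSucc_zero]; exact w)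
  have hS : S.Exact := by
    rw [ShortComplex.moduleCat_exact_iff_ker_sub_range]
    rw [← negComplex_d_negSucc_zero P d hd] at h
    exact h
  have : Epi S.g := (ModuleCat.epi_iff_surjective _).2 hπ
  let D := ShortComplex.LeftHomologyData.ofIsColimitCokernelCofork (K.sc' (-1) 0 1)
    (negComplex_d_zero P d hd) _ hS.gIsCokernel
  exact ⟨ShortComplex.homologyMapIso (K.isoSc' (-1) 0 1 (by simp) (by simp)) ≪≫ D.homologyIso⟩

lemma isFiniteProjectiveComplex_negComplex {n : ℕ} (h1 : ∀ k, Module.Finite A (P k))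
    (h2 : ∀ k, Module.Projective A (P k)) (h3 : ∀ k, n < k → Subsingleton (P k)) :
    IsFiniteProjectiveComplex (negComplex P d hd) (-n) 0 where
  isStrictlyGE := by
    rw [CochainComplex.isStrictlyGE_iff]
    rintro (j | j) hj
    · simp at hj; omega
    · have := h3 (j + 1) (by omega)
      exact ModuleCat.isZero_of_subsingleton (P (j + 1))
  isStrictlyLE := by
    rw [CochainComplex.isStrictlyLE_iff]
    rintro ((_ | j) | j) hj
    · simp at hj
    · exact ModuleCat.isZero_of_subsingleton (ModuleCat.of A PUnit.{u + 1})
    · simp at hj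
  finite := by
    rintro ((_ | j) | j)
    · exact h1 0
    · exact inferInstanceAs (Module.Finite A PUnit.{u + 1})
    · exact h1 (j + 1)
  projective := by
    rintro ((_ | j) | j)
    · exact h2 0
    · exact inferInstanceAs (Module.Projective A PUnit.{u + 1})
    · exact h2 (j + 1)

end Resolution

/-! ### The bound on the global dimension -/

section Main

variable {A : Type u} [Ring A]

lemma QuasiIsomorphic.refl (K : CochainComplex (ModuleCat.{u} A) ℤ) : QuasiIsomorphic K K :=
  ⟨Iso.refl _⟩

lemma QuasiIsomorphic.nonempty_homology_iso {K L : CochainComplex (ModuleCat.{u} A) ℤ}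
    (h : QuasiIsomorphic K L) (j : ℤ) : Nonempty (K.homology j ≅ L.homology j) := by
  let : HasDerivedCategory (ModuleCat.{u} A) := HasDerivedCategory.standard _
  obtain ⟨e⟩ := h
  let φ := DerivedCategory.homologyFunctorFactors (ModuleCat.{u} A) j
  exact ⟨(φ.app K).symm ≪≫ (DerivedCategory.homologyFunctor _ j).mapIso e ≪≫ φ.app L⟩

/-- If a complex decomposes in the derived category as a finite direct sum of complexes of
finitely generated projective modules of length `≤ r`, and has cohomology only in the degrees `0`
and `-(r + 1)`, then its cohomology in degree `0` has projective dimension `≤ r`. -/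
lemma hasProjectiveDimensionLE_homology_zero {r s : ℕ}
    {K : CochainComplex (ModuleCat.{u} A) ℤ} {F : Fin s → CochainComplex (ModuleCat.{u} A) ℤ}
    (hF : ∀ i, ∃ a b : ℤ, b - a ≤ r ∧ IsFiniteProjectiveComplex (F i) a b)
    (e : QuasiIsomorphic K (∐ F))
    (hK : ∀ j : ℤ, j ≠ 0 → j ≠ -(r + 1 : ℕ) → K.ExactAt j) :
    HasProjectiveDimensionLE (K.homology 0) r := by
  classical
  let p (i : Fin s) : ∐ F ⟶ F i := Sigma.π F i
  have hιp (i : Fin s) : Sigma.ι F i ≫ p i = 𝟙 _ := Sigma.ι_π_eq_id F i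
  have hid : ∑ i, p i ≫ Sigma.ι F i = 𝟙 (∐ F) := by
    refine Sigma.hom_ext _ _ fun i ↦ ?_
    rw [Preadditive.comp_sum, Finset.sum_eq_single i]
    · simp [p]
    · intro j _ hj
      rw [← Category.assoc, Sigma.ι_π_of_ne F hj.symm, zero_comp]
    · simp
  have hexact (i : Fin s) (j : ℤ) (hj : j ≠ 0) (hjr : j ≠ -(r + 1 : ℕ)) : (F i).ExactAt j := by
    rw [HomologicalComplex.exactAt_iff_isZero_homology]
    obtain ⟨f⟩ := e.nonempty_homology_iso j
    have hz := (((K.exactAt_iff_isZero_homology j).1 (hK j hj hjr)).of_iso f.symm)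
    -- The identity of `H^j(F i)` factors through `H^j(∐ F)`, which is zero.
    rw [IsZero.iff_id_eq_zero, ← HomologicalComplex.homologyMap_id, ← hιp i,
      HomologicalComplex.homologyMap_comp, hz.eq_of_tgt (HomologicalComplex.homologyMap _ _) 0,
      zero_comp]
  have hpd (i : Fin s) : HasProjectiveDimensionLE ((F i).homology 0) r := by
    obtain ⟨a, b, hab, hi⟩ := hF i
    by_cases h0 : 0 < a ∨ b < 0
    · have := (((F i).exactAt_iff_isZero_homology 0).1
        (hi.exactAt h0)).hasProjectiveDimensionLT_zero
      exact hasProjectiveDimensionLT_of_ge _ 0 _ (Nat.zero_le _)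
    · refine hi.hasProjectiveDimensionLE_homology_zero (fun j hj ↦ ?_) r (by omega)
      -- Here `0 ≤ b` and `b - a ≤ r` give `a ≥ -r`, so degree `-(r + 1)` lies below the range of `F
      -- i`.
      by_cases hjr : j = -(r + 1 : ℕ)
      · exact hi.exactAt (Or.inl (by omega))
      · exact hexact i j hj hjr
  obtain ⟨f⟩ := e.nonempty_homology_iso 0
  have := hasProjectiveDimensionLT_of_sum_eq_id (X := (∐ F).homology 0)
    (fun i ↦ HomologicalComplex.homologyMap (p i) 0)
    (fun i ↦ HomologicalComplex.homologyMap (Sigma.ι F i) 0) (by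
      have := congrArg (HomologicalComplex.homologyFunctor _ _ 0).map hid
      rw [Functor.map_sum, CategoryTheory.Functor.map_id] at this
      simp only [HomologicalComplex.homologyFunctor_map, HomologicalComplex.homologyMap_comp]
        at this
      exact this) (r + 1) hpd
  exact hasProjectiveDimensionLT_of_iso f.symm (r + 1)

/-- A finitely generated module over a noetherian strongly `r`-regular ring has projective
dimension `≤ r`. -/
theorem IsStronglyRegular.hasProjectiveDimensionLE_of_finite [IsNoetherianRing A] {r : ℕ}
    (hA : IsStronglyRegular A r) (M : ModuleCat.{u} A) [Module.Finite A M] :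
    HasProjectiveDimensionLE M r := by
  -- With `r + 1` steps, the two cohomology degrees are just too far apart for one summand to
  -- contain both.
  obtain ⟨P, d, π, h1, h2, h3, h4, h5, h6, h7, h8⟩ := exists_truncated_resolution (r + 1) M
  obtain ⟨s, F, hF, e⟩ := hA (negComplex P d h6)
    ⟨_, _, _, isFiniteProjectiveComplex_negComplex P d h6 h1 h2 h3, QuasiIsomorphic.refl _⟩
  have := hasProjectiveDimensionLE_homology_zero hF e (exactAt_negComplex P d h6 h8)
  obtain ⟨f⟩ := nonempty_homology_negComplex_iso P d h6 π h4 h5 (h7 (Nat.succ_pos r))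
  exact hasProjectiveDimensionLT_of_iso f (r + 1)

open Abelian in
/-- A module `N` such that `Ext^(n + 1)(M, N) = 0` for all finitely generated modules `M` has
injective dimension `≤ n`. -/
lemma hasInjectiveDimensionLT_of_forall_finite (n : ℕ) (N : ModuleCat.{u} A)
    (h : ∀ M : ModuleCat.{u} A, Module.Finite A M → Subsingleton (Ext M N (n + 1))) :
    HasInjectiveDimensionLT N (n + 1) := by
  induction n generalizing N with
  | zero =>
    rw [zero_add, ← injective_iff_hasInjectiveDimensionLT_one]
    have hB : Module.Baer A N := fun I g ↦ by
      have hS := LinearMap.shortExact_shortComplexKer I.mkQ_surjective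
      have := h (ModuleCat.of A (A ⧸ I)) inferInstance
      let e : I →ₗ[A] LinearMap.ker I.mkQ := (LinearEquiv.ofEq _ _ I.ker_mkQ.symm).toLinearMap
      let g' : ModuleCat.of A (LinearMap.ker I.mkQ) ⟶ N :=
        ModuleCat.ofHom (g ∘ₗ (LinearEquiv.ofEq _ _ I.ker_mkQ).toLinearMap)
      -- The obstruction to extending `g` from `I` to `A` lies in `Ext^1(A ⧸ I, N) = 0`.
      obtain ⟨φ, hφ⟩ := Ext.contravariant_sequence_exact₁ hS N (Ext.mk₀ g') (add_zero 1)
        (Subsingleton.elim (α := Ext (ModuleCat.of A (A ⧸ I)) N 1) _ _)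
      obtain ⟨φ, rfl⟩ := Ext.homEquiv₀.symm.surjective φ
      have h1 : ModuleCat.ofHom (LinearMap.ker I.mkQ).subtype ≫ φ = g' :=
        Ext.homEquiv₀.symm.injective (by simpa using hφ)
      refine ⟨φ.hom, fun x hx ↦ ?_⟩
      exact congrArg (fun f ↦ f.hom ⟨x, I.ker_mkQ.symm ▸ hx⟩) h1
    have := hB.injective
    exact Module.injective_object_of_injective_module A N
  | succ n ih =>
    -- Dimension shift: the cokernel of an embedding of `N` into an injective inherits the vanishing
    -- one degree lower.
    let ⟨p⟩ := EnoughInjectives.presentation N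
    have hS : (ShortComplex.mk _ _ (cokernel.condition p.f)).ShortExact :=
      { exact := ShortComplex.exact_cokernel p.f }
    have := p.injective
    refine hS.hasInjectiveDimensionLT_X₁ (n + 1) (ih _ fun M hM ↦ ?_) inferInstance
    refine ⟨fun a b ↦ sub_eq_zero.1 ?_⟩
    have := h M hM
    obtain ⟨y, hy⟩ := Ext.covariant_sequence_exact₃ M hS (a - b) rfl
      (Subsingleton.elim (α := Ext M N (n + 1 + 1)) _ _)
    rw [← hy, y.eq_zero_of_injective, Ext.zero_comp]

/-- If the finitely generated modules have projective dimension `≤ n`, then so do all modules. -/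
theorem hasProjectiveDimensionLE_of_forall_finite {n : ℕ}
    (h : ∀ M : ModuleCat.{u} A, Module.Finite A M → HasProjectiveDimensionLE M n)
    (M : ModuleCat.{u} A) : HasProjectiveDimensionLE M n := by
  refine (hasProjectiveDimensionLT_iff _ _).2 fun i hi N e ↦ ?_
  -- The roles are exchanged: `Ext(M, N)` is killed by the injective dimension of `N`, which only
  -- finitely generated modules test.
  have := hasInjectiveDimensionLT_of_forall_finite n N fun L hL ↦
    have := h L hL
    HasProjectiveDimensionLT.subsingleton L (n + 1) (n + 1) le_rfl N
  exact e.eq_zero_of_hasInjectiveDimensionLT (n + 1) hi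

theorem IsStronglyRegular.hasProjectiveDimensionLE [IsNoetherianRing A] {r : ℕ}
    (hA : IsStronglyRegular A r) (M : ModuleCat.{u} A) : HasProjectiveDimensionLE M r :=
  hasProjectiveDimensionLE_of_forall_finite
    (fun N _ ↦ hA.hasProjectiveDimensionLE_of_finite N) M

theorem IsStronglyRegular.globalDimension_le [IsNoetherianRing A] {r : ℕ}
    (hA : IsStronglyRegular A r) : globalDimension A ≤ (r : WithBot ℕ∞) :=
  iSup_le fun M ↦ (projectiveDimension_le_iff M r).2 (hA.hasProjectiveDimensionLE M)

end Main

/-! ### Modules of finite projective dimension over a local ring with nonzero socle -/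

section Local

open IsLocalRing TensorProduct

variable {R : Type u} [CommRing R] [IsLocalRing R]

/-- A finitely generated module over a local ring has a free cover whose kernel lies in the
maximal ideal times the cover. -/
lemma exists_minimal_cover (M : Type u) [AddCommGroup M] [Module R M] [Module.Finite R M] :
    ∃ (n : ℕ) (f : (Fin n → R) →ₗ[R] M), Function.Surjective f ∧
      ∀ a, f a = 0 → ∀ i, a i ∈ maximalIdeal R := by
  let b := Module.finBasis (ResidueField R) (ResidueField R ⊗[R] M)
  have hs : Function.Surjective (TensorProduct.mk R (ResidueField R) M 1) :=
    TensorProduct.mk_surjective R M _ Ideal.Quotient.mk_surjective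
  choose v hv using fun i ↦ hs (b i)
  refine ⟨_, Fintype.linearCombination R v, ?_, fun a ha i ↦ ?_⟩
  · rw [← LinearMap.range_eq_top, Fintype.range_linearCombination]
    exact span_eq_top_of_tmul_eq_basis v b hv
  · have h : ∑ i, residue R (a i) • b i = 0 := by
      have := congrArg (TensorProduct.mk R (ResidueField R) M 1) ha
      rw [Fintype.linearCombination_apply, map_sum, map_zero] at this
      rw [← this]
      refine Finset.sum_congr rfl fun i _ ↦ ?_
      rw [map_smul, hv]
      exact (algebraMap_smul (ResidueField R) (a i) (b i))
    exact (residue_eq_zero_iff _).1 (Fintype.linearIndependent_iff.1 b.linearIndependent _ h i)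

/-- If the maximal ideal of a noetherian local ring is killed by a nonzero element, then the
finitely generated modules of finite projective dimension are free. -/
lemma free_of_hasProjectiveDimensionLT [IsNoetherianRing R] {s : R} (hs : s ≠ 0)
    (hm : ∀ a ∈ maximalIdeal R, s * a = 0) (n : ℕ) (M : Type u) [AddCommGroup M] [Module R M]
    [Module.Finite R M] [HasProjectiveDimensionLT (ModuleCat.of R M) (n + 1)] :
    Module.Free R M := by
  induction n generalizing M with
  | zero =>
    have : Module.Projective R M := projective_of_hasProjectiveDimensionLT_one M
    exact Module.free_of_flat_of_isLocalRing
  | succ n ih =>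
    obtain ⟨m, f, hf, hker⟩ := exists_minimal_cover (R := R) M
    have hS := LinearMap.shortExact_shortComplexKer hf
    have hfree : Module.Free R (Fin m → R) := Module.Free.function (Fin m) R R
    have : Projective (ModuleCat.of R (Fin m → R)) :=
      (IsProjective.iff_projective _).1 (@Module.Projective.of_free _ _ _ _ _ hfree)
    have : HasProjectiveDimensionLT (ModuleCat.of R (LinearMap.ker f)) (n + 1) :=
      (hS.hasProjectiveDimensionLT_X₃_iff n this).1 ‹_›
    have := ih (LinearMap.ker f)
    have hinj : LinearMap.ker f = ⊥ := by
      by_contra hne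
      have : Nontrivial (LinearMap.ker f) := Submodule.nontrivial_iff_ne_bot.2 hne
      let b := Module.Free.chooseBasis R (LinearMap.ker f)
      obtain ⟨i⟩ := b.index_nonempty
      -- The kernel of a minimal cover has coordinates in the maximal ideal, so `s` kills it; a
      -- nonzero free module is not killed by `s ≠ 0`.
      have h0 : s • b i = 0 := by
        ext j
        exact hm _ (hker _ (b i).2 j)
      have := congrArg (fun z ↦ b.repr z i) h0
      exact hs (by simpa using this)
    exact Module.Free.of_equiv (LinearEquiv.ofBijective f ⟨LinearMap.ker_eq_bot.1 hinj, hf⟩)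

end Local

/-! ### Reduction modulo a regular element -/

section BaseChange

open TensorProduct

variable {R : Type u} [CommRing R]

lemma one_tmul_quotient_span_singleton_eq_zero_iff {M : Type u} [AddCommGroup M] [Module R M]
    (x : R) (m : M) : (1 : R ⧸ Ideal.span {x}) ⊗ₜ[R] m = 0 ↔ ∃ y : M, x • y = m := by
  rw [← (quotTensorEquivQuotSMul M (Ideal.span {x})).map_eq_zero_iff,
    show (1 : R ⧸ Ideal.span {x}) = Ideal.Quotient.mk _ 1 from rfl,
    quotTensorEquivQuotSMul_mk_tmul, one_smul, Submodule.Quotient.mk_eq_zero,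
    Submodule.ideal_span_singleton_smul, Submodule.mem_smul_pointwise_iff_exists]
  simp

lemma exact_baseChange (S : Type u) [CommRing S] [Algebra R S] {L M N : Type u} [AddCommGroup L]
    [Module R L] [AddCommGroup M] [Module R M] [AddCommGroup N] [Module R N] {f : L →ₗ[R] M}
    {g : M →ₗ[R] N} (h : Function.Exact f g) (hg : Function.Surjective g) :
    Function.Exact (f.baseChange S) (g.baseChange S) := by
  rw [LinearMap.baseChange_eq_ltensor, LinearMap.baseChange_eq_ltensor]
  exact lTensor_exact S h hg

/-- If `k = x • y` lies in `ker f`, then `x • f y = 0`, so `f y = 0` by regularity and `k` is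
already a multiple of `x` inside `ker f`. -/
lemma injective_baseChange_subtype_ker {M N : Type u} [AddCommGroup M] [Module R M] [AddCommGroup N]
    [Module R N] {x : R} (hN : IsSMulRegular N x) (f : M →ₗ[R] N) :
    Function.Injective ((LinearMap.ker f).subtype.baseChange (R ⧸ Ideal.span {x})) := by
  rw [injective_iff_map_eq_zero]
  intro z hz
  obtain ⟨k, rfl⟩ := TensorProduct.mk_surjective R (LinearMap.ker f) _
    Ideal.Quotient.mk_surjective z
  rw [TensorProduct.mk_apply] at hz ⊢
  rw [LinearMap.baseChange_tmul, one_tmul_quotient_span_singleton_eq_zero_iff] at hz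
  obtain ⟨y, hy⟩ := hz
  rw [one_tmul_quotient_span_singleton_eq_zero_iff]
  have hk : f y = 0 := hN <| by
    change x • f y = x • 0
    rw [← map_smul, hy, smul_zero]
    exact k.2
  exact ⟨⟨y, hk⟩, Subtype.ext hy⟩

lemma hasProjectiveDimensionLT_baseChange_of_ker {F M : Type u} [AddCommGroup F] [Module R F]
    [Module.Projective R F] [AddCommGroup M] [Module R M] {x : R} (hM : IsSMulRegular M x)
    (f : F →ₗ[R] M) (hf : Function.Surjective f) (n : ℕ)
    (h : HasProjectiveDimensionLT (ModuleCat.of (R ⧸ Ideal.span {x})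
      ((R ⧸ Ideal.span {x}) ⊗[R] LinearMap.ker f)) (n + 1)) :
    HasProjectiveDimensionLT
      (ModuleCat.of (R ⧸ Ideal.span {x}) ((R ⧸ Ideal.span {x}) ⊗[R] M)) (n + 2) := by
  have hex := exact_baseChange (R ⧸ Ideal.span {x}) f.exact_subtype_ker_map hf
  let T := ModuleCat.shortComplexOfCompEqZero
    ((LinearMap.ker f).subtype.baseChange (R ⧸ Ideal.span {x}))
    (f.baseChange (R ⧸ Ideal.span {x})) hex.linearMap_comp_eq_zero
  have hT : T.ShortExact :=
    { exact := ModuleCat.shortComplex_exact T hex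
      mono_f := (ModuleCat.mono_iff_injective _).2 (injective_baseChange_subtype_ker hM f)
      epi_g := (ModuleCat.epi_iff_surjective _).2
        (LinearMap.lTensor_surjective (R ⧸ Ideal.span {x}) hf) }
  have hproj : Module.Projective (R ⧸ Ideal.span {x}) ((R ⧸ Ideal.span {x}) ⊗[R] F) :=
    inferInstance
  exact (hT.hasProjectiveDimensionLT_X₃_iff n ((IsProjective.iff_projective _).1 hproj)).2 h

/-- Reduction modulo a regular element does not increase the projective dimension of the modules on
which the element is regular. -/
lemma hasProjectiveDimensionLT_baseChange {x : R} (hR : IsSMulRegular R x) (n : ℕ) (M : Type u)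
    [AddCommGroup M] [Module R M] (hM : IsSMulRegular M x)
    [HasProjectiveDimensionLT (ModuleCat.of R M) (n + 1)] :
    HasProjectiveDimensionLT
      (ModuleCat.of (R ⧸ Ideal.span {x}) ((R ⧸ Ideal.span {x}) ⊗[R] M)) (n + 1) := by
  induction n generalizing M with
  | zero =>
    have : Module.Projective R M := projective_of_hasProjectiveDimensionLT_one M
    exact hasProjectiveDimensionLT_one_of_projective _
  | succ n ih =>
    -- The cover is free, so `x` is regular on it and on the kernel, to which the induction
    -- hypothesis applies.
    obtain ⟨F, _, _, _, hF, f, hf⟩ : ∃ (F : Type u) (_ : AddCommGroup F) (_ : Module R F)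
        (_ : Module.Projective R F) (_ : IsSMulRegular F x) (f : F →ₗ[R] M),
        Function.Surjective f :=
      ⟨M →₀ R, inferInstance, inferInstance, inferInstance,
        fun a b h ↦ Finsupp.ext fun i ↦ hR (DFunLike.congr_fun h i),
        Finsupp.linearCombination R id, Finsupp.linearCombination_id_surjective R M⟩
    have hK : IsSMulRegular (LinearMap.ker f) x := fun a b h ↦
      Subtype.ext (hF (congrArg Subtype.val h))
    have hS := LinearMap.shortExact_shortComplexKer hf
    have hproj : Projective (ModuleCat.of R F) := (IsProjective.iff_projective _).1 inferInstance
    have : HasProjectiveDimensionLT (ModuleCat.of R (LinearMap.ker f)) (n + 1) :=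
      (hS.hasProjectiveDimensionLT_X₃_iff n hproj).1 ‹_›
    exact hasProjectiveDimensionLT_baseChange_of_ker hM f hf n (ih (LinearMap.ker f) hK)

end BaseChange

/-! ### The maximal ideal of the quotient as a direct summand -/

section Retract

open IsLocalRing TensorProduct

variable {R S : Type u} [CommRing R] [IsLocalRing R] [CommRing S] [IsLocalRing S] [Algebra R S]

/-- There is a linear form on the maximal ideal with values in the residue field taking the value
`1` at a given element outside of the square of the maximal ideal. -/
lemma exists_linearMap_residueField_eq_one {x : R} (hx : x ∈ maximalIdeal R)
    (hx2 : x ∉ maximalIdeal R ^ 2) :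
    ∃ l : maximalIdeal R →ₗ[R] ResidueField R, l ⟨x, hx⟩ = 1 := by
  have h0 : (maximalIdeal R).toCotangent ⟨x, hx⟩ ≠ 0 := fun h ↦
    hx2 (((maximalIdeal R).toCotangent_eq_zero _).1 h)
  have h1 := mt (Module.forall_dual_apply_eq_zero_iff (ResidueField R)
    (V := CotangentSpace R) _).1 h0
  push Not at h1
  obtain ⟨φ, hφ⟩ := h1
  let ψ : CotangentSpace R →ₗ[ResidueField R] ResidueField R :=
    (φ ((maximalIdeal R).toCotangent ⟨x, hx⟩))⁻¹ • φ
  exact ⟨ψ.restrictScalars R ∘ₗ (maximalIdeal R).toCotangent, inv_mul_cancel₀ hφ⟩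

variable (S) in
/-- The restriction of a surjection of local rings to the maximal ideals. -/
def maximalIdealMap (hS : Function.Surjective (algebraMap R S)) :
    maximalIdeal R →ₗ[R] maximalIdeal S where
  toFun a := ⟨algebraMap R S a, by
    have := IsLocalHom.of_surjective (algebraMap R S) hS
    have ha : (a : R) ∈ (maximalIdeal S).comap (algebraMap R S) := by
      rw [maximalIdeal_comap]
      exact a.2
    exact ha⟩
  map_add' a b := Subtype.ext (map_add _ _ _)
  map_smul' r a := Subtype.ext ((map_mul _ _ _).trans (Algebra.smul_def _ _).symm)

lemma surjective_maximalIdealMap (hS : Function.Surjective (algebraMap R S)) :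
    Function.Surjective (maximalIdealMap S hS) := by
  have := IsLocalHom.of_surjective (algebraMap R S) hS
  rintro ⟨b, hb⟩
  obtain ⟨a, rfl⟩ := hS b
  exact ⟨⟨a, by rwa [← maximalIdeal_comap (algebraMap R S)]⟩, rfl⟩

/-- If `S` is the quotient of a local ring `R` by an element `x` of the maximal ideal `m` outside of
`m ^ 2`, then the maximal ideal of `S` is a direct summand of `S ⊗ m`. -/
lemma exists_retraction_baseChange_maximalIdeal (hS : Function.Surjective (algebraMap R S)) {x : R}
    (hx : x ∈ maximalIdeal R) (hx2 : x ∉ maximalIdeal R ^ 2)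
    (hker : ∀ a, algebraMap R S a = 0 → x ∣ a) (hxS : algebraMap R S x = 0) :
    ∃ (σ : maximalIdeal S →ₗ[S] S ⊗[R] maximalIdeal R)
      (p : S ⊗[R] maximalIdeal R →ₗ[S] maximalIdeal S), p ∘ₗ σ = LinearMap.id := by
  obtain ⟨l, hl⟩ := exists_linearMap_residueField_eq_one hx hx2
  let q := maximalIdealMap S hS
  have hq : Function.Surjective q := surjective_maximalIdealMap hS
  let t : S ⊗[R] maximalIdeal R := 1 ⊗ₜ ⟨x, hx⟩
  -- In `S ⊗ m`, `c • (1 ⊗ x) = 1 ⊗ (x • c) = x • (1 ⊗ c)`, and `x` is zero in `S`.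
  have ht (c : R) (hc : c ∈ maximalIdeal R) : c • t = 0 := by
    have : c • (⟨x, hx⟩ : maximalIdeal R) = x • ⟨c, hc⟩ := Subtype.ext (mul_comm c x)
    rw [← TensorProduct.tmul_smul, this, TensorProduct.tmul_smul, TensorProduct.smul_tmul',
      Algebra.smul_def, hxS, zero_mul, TensorProduct.zero_tmul]
  let g : ResidueField R →ₗ[R] S ⊗[R] maximalIdeal R :=
    Submodule.liftQ (maximalIdeal R) (LinearMap.toSpanSingleton R _ t) ht
  have hg (c : R) : g (residue R c) = c • t := rfl
  -- The correction `l a • t` makes `a ↦ 1 ⊗ a` vanish at `x`, since `l x = 1`; the map then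
  -- descends to the maximal ideal of `S`. The projection kills `t`, so the correction does not
  -- affect the retraction.
  let ψ : maximalIdeal R →ₗ[R] S ⊗[R] maximalIdeal R := TensorProduct.mk R S _ 1 - g ∘ₗ l
  have hψ : LinearMap.ker q ≤ LinearMap.ker ψ := by
    intro a ha
    obtain ⟨c, hc⟩ := hker a (congrArg Subtype.val (LinearMap.mem_ker.1 ha))
    have ha' : a = c • ⟨x, hx⟩ := Subtype.ext (hc.trans (mul_comm x c))
    rw [LinearMap.mem_ker, ha', map_smul]
    have : ψ ⟨x, hx⟩ = 0 := by
      change t - g (l ⟨x, hx⟩) = 0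
      rw [hl, ← map_one (residue R), hg, one_smul, sub_self]
    rw [this, smul_zero]
  let σ₀ : maximalIdeal S →ₗ[R] S ⊗[R] maximalIdeal R :=
    (LinearMap.ker q).liftQ ψ hψ ∘ₗ (q.quotKerEquivOfSurjective hq).symm.toLinearMap
  have hσ₀ (a : maximalIdeal R) : σ₀ (q a) = ψ a := by
    have : (q.quotKerEquivOfSurjective hq).symm (q a) = Submodule.Quotient.mk a :=
      (LinearEquiv.symm_apply_eq _).2 rfl
    change (LinearMap.ker q).liftQ ψ hψ ((q.quotKerEquivOfSurjective hq).symm (q a)) = ψ a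
    rw [this]
    rfl
  refine ⟨σ₀.extendScalarsOfSurjective hS, q.liftBaseChange S, LinearMap.ext fun b ↦ ?_⟩
  obtain ⟨a, rfl⟩ := hq b
  obtain ⟨c, hc⟩ := residue_surjective (l a)
  have hqx : q ⟨x, hx⟩ = 0 := Subtype.ext hxS
  change q.liftBaseChange S (σ₀ (q a)) = q a
  rw [hσ₀]
  change q.liftBaseChange S (1 ⊗ₜ a - g (l a)) = q a
  have h0 : q.liftBaseChange S (c • t) = 0 := by
    rw [← algebraMap_smul S c t, map_smul, LinearMap.liftBaseChange_tmul, hqx, smul_zero, smul_zero]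
  rw [← hc, hg, map_sub, h0, sub_zero, LinearMap.liftBaseChange_tmul, one_smul]

end Retract

/-! ### Serre's theorem for local rings -/

section Serre

open IsLocalRing TensorProduct RingTheory.Sequence

variable {R : Type u} [CommRing R] [IsLocalRing R] [IsNoetherianRing R]

/-- If the residue field of a noetherian local ring which is not a field has finite projective
dimension, then there is a regular element in the maximal ideal `m` outside of `m ^ 2`. -/
lemma exists_isSMulRegular_notMem_sq (hm : maximalIdeal R ≠ ⊥) (n : ℕ)
    [HasProjectiveDimensionLT (ModuleCat.of R (R ⧸ maximalIdeal R)) (n + 1)] :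
    ∃ x ∈ maximalIdeal R, x ∉ maximalIdeal R ^ 2 ∧ IsSMulRegular R x := by
  by_contra! hcon
  have hsub : (maximalIdeal R : Set R) ⊆
      ⋃ p ∈ insert (maximalIdeal R ^ 2) (associatedPrimes R R), (id p : Ideal R) := by
    intro x hx
    rw [Set.biUnion_insert]
    by_cases hx2 : x ∈ maximalIdeal R ^ 2
    · exact Or.inl hx2
    · refine Or.inr ?_
      simp only [id]
      rw [biUnion_associatedPrimes_eq_compl_nonZeroDivisors]
      exact fun h ↦ hcon x hx hx2 (Module.Flat.isSMulRegular_of_nonZeroDivisors h)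
  -- Prime avoidance, with `m ^ 2` as the one ideal allowed not to be prime. If `m ≤ m ^ 2`,
  -- Nakayama gives `m = 0`; if `m` lies in an associated prime, a nonzero `s` kills `m`, the
  -- residue field is free, and its annihilator `m` is zero.
  rw [Ideal.subset_union_prime_finite ((associatedPrimes.finite R R).insert _)
    (maximalIdeal R ^ 2) (maximalIdeal R ^ 2)] at hsub
  · obtain ⟨p, rfl | hp, hle⟩ := hsub
    · refine hm (Submodule.eq_bot_of_le_smul_of_le_jacobson_bot (maximalIdeal R) _
        (maximalIdeal R).fg_of_isNoetherianRing ?_ (IsLocalRing.maximalIdeal_le_jacobson _))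
      rwa [smul_eq_mul, ← sq]
    · obtain ⟨hprime, s, hs⟩ := isAssociatedPrime_iff.1 hp
      have hs0 : s ≠ 0 := by
        rintro rfl
        exact hprime.ne_top (hs.trans (by simp))
      have hms (a : R) (ha : a ∈ maximalIdeal R) : s * a = 0 := by
        have h1 : a ∈ (⊥ : Submodule R R).colon {s} := hs ▸ hle ha
        rw [Submodule.mem_colon_singleton, Submodule.mem_bot, smul_eq_mul] at h1
        rw [mul_comm, h1]
      have hfree := free_of_hasProjectiveDimensionLT hs0 hms n (R ⧸ maximalIdeal R)
      have : Nontrivial (R ⧸ maximalIdeal R) :=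
        Ideal.Quotient.nontrivial_iff.2 (maximalIdeal.isMaximal R).ne_top
      refine hm (eq_bot_iff.2 fun a ha ↦ ?_)
      have h2 : a ∈ Module.annihilator R (R ⧸ maximalIdeal R) := by
        rwa [Ideal.annihilator_quotient]
      rwa [Module.annihilator_eq_bot.2 inferInstance] at h2
  · rintro p (rfl | hp) h1 -
    · exact (h1 rfl).elim
    · exact hp.isPrime

omit [IsNoetherianRing R] in
/-- If the residue field of a noetherian local ring `R` has finite projective dimension, then so has
the residue field of the quotient of `R` by a regular element `x` of the maximal ideal `m` outside
of `m ^ 2`. -/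
lemma hasProjectiveDimensionLT_residueField_quotient {x : R} (hx : x ∈ maximalIdeal R)
    (hx2 : x ∉ maximalIdeal R ^ 2) (hreg : IsSMulRegular R x) [IsLocalRing (R ⧸ Ideal.span {x})]
    (n : ℕ) [HasProjectiveDimensionLT (ModuleCat.of R (R ⧸ maximalIdeal R)) (n + 2)] :
    HasProjectiveDimensionLT (ModuleCat.of (R ⧸ Ideal.span {x})
      ((R ⧸ Ideal.span {x}) ⧸ maximalIdeal (R ⧸ Ideal.span {x}))) (n + 2) := by
  have hS := LinearMap.shortExact_shortComplexKer (maximalIdeal R).mkQ_surjective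
  have hR := hasProjectiveDimensionLT_one_of_projective (A := R) R
  -- Passing to `m` lowers the bound by one; the last quotient restores it, so the bound for the
  -- residue field is unchanged.
  have hker : HasProjectiveDimensionLT
      (ModuleCat.of R (LinearMap.ker (maximalIdeal R).mkQ)) (n + 1) :=
    hS.hasProjectiveDimensionLT_X₁ (n + 1) (hasProjectiveDimensionLT_of_ge _ 1 _ (by omega)) ‹_›
  have hm : HasProjectiveDimensionLT (ModuleCat.of R (maximalIdeal R)) (n + 1) :=
    hasProjectiveDimensionLT_of_linearEquiv
      (LinearEquiv.ofEq _ _ (maximalIdeal R).ker_mkQ) (n + 1)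
  have hmreg : IsSMulRegular (maximalIdeal R) x := fun a b h ↦
    Subtype.ext (hreg (congrArg Subtype.val h))
  have hb := hasProjectiveDimensionLT_baseChange hreg n (maximalIdeal R) hmreg
  obtain ⟨σ, p, hp⟩ := exists_retraction_baseChange_maximalIdeal (S := R ⧸ Ideal.span {x})
    Ideal.Quotient.mk_surjective hx hx2
    (fun a ha ↦ Ideal.mem_span_singleton.1 (Ideal.Quotient.eq_zero_iff_mem.1 ha))
    (Ideal.Quotient.eq_zero_iff_mem.2 (Ideal.mem_span_singleton_self x))
  have hr : Retract (ModuleCat.of (R ⧸ Ideal.span {x}) (maximalIdeal (R ⧸ Ideal.span {x})))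
      (ModuleCat.of (R ⧸ Ideal.span {x}) ((R ⧸ Ideal.span {x}) ⊗[R] maximalIdeal R)) :=
    ⟨ModuleCat.ofHom σ, ModuleCat.ofHom p, ModuleCat.hom_ext hp⟩
  have := hr.hasProjectiveDimensionLT (n + 1)
  exact hasProjectiveDimensionLT_quotient (maximalIdeal (R ⧸ Ideal.span {x})) (n + 1)

omit [IsNoetherianRing R] in
/-- A sequence beginning with a regular element `x` and continuing with a lift of a regular
sequence generating the maximal ideal of the quotient by `x` is regular and generates the maximal
ideal. -/
lemma isRegular_cons_of_quotient {x : R} (hreg : IsSMulRegular R x)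
    [IsLocalRing (R ⧸ Ideal.span {x})] (rs : List R)
    (hrs : IsRegular (R ⧸ Ideal.span {x}) (rs.map (algebraMap R (R ⧸ Ideal.span {x}))))
    (hmax : Ideal.ofList (rs.map (algebraMap R (R ⧸ Ideal.span {x}))) =
      maximalIdeal (R ⧸ Ideal.span {x})) :
    IsRegular R (x :: rs) ∧ Ideal.ofList (x :: rs) = maximalIdeal R := by
  have hsurj : Function.Surjective (algebraMap R (R ⧸ Ideal.span {x})) :=
    Ideal.Quotient.mk_surjective
  have := IsLocalHom.of_surjective (algebraMap R (R ⧸ Ideal.span {x})) hsurj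
  have hker : Ideal.comap (algebraMap R (R ⧸ Ideal.span {x})) ⊥ = Ideal.span {x} :=
    Ideal.mk_ker
  have heq : Ideal.ofList (x :: rs) = maximalIdeal R := by
    rw [Ideal.ofList_cons, ← maximalIdeal_comap (algebraMap R (R ⧸ Ideal.span {x})), ← hmax,
      ← Ideal.map_ofList, Ideal.comap_map_of_surjective _ hsurj, hker, sup_comm]
  refine ⟨IsRegular.of_isWeaklyRegular_of_mem_maximalIdeal R (fun r hr ↦ ?_)
    (IsWeaklyRegular.cons hreg ?_), heq⟩
  · rw [← heq]
    exact Ideal.subset_span hr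
  · have h1 := (isWeaklyRegular_map_algebraMap_iff _ _ rs).1 hrs.toIsWeaklyRegular
    refine (LinearEquiv.isWeaklyRegular_congr (Submodule.quotEquivOfEq _ _ ?_) rs).1 h1
    rw [← Submodule.ideal_span_singleton_smul, smul_eq_mul, Ideal.mul_top]

/-- If the residue field of a noetherian local ring has finite projective dimension, then the
maximal ideal is generated by a regular sequence. -/
theorem exists_isRegular_ofList_eq_maximalIdeal (n : ℕ)
    [HasProjectiveDimensionLT (ModuleCat.of R (R ⧸ maximalIdeal R)) (n + 2)] :
    ∃ rs : List R, IsRegular R rs ∧ Ideal.ofList rs = maximalIdeal R := by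
  obtain ⟨d, hd⟩ : ∃ d : ℕ, ringKrullDim R < d := by
    obtain ⟨d, hd⟩ := (WithBot.ne_bot_iff_exists).1 (ringKrullDim_ne_bot (R := R))
    have h := ringKrullDim_ne_top (R := R)
    induction d with
    | top => exact (h hd.symm).elim
    | coe d => exact ⟨d + 1, by rw [← hd]; exact_mod_cast Nat.lt_succ_self d⟩
  -- The induction is on a strict bound for the dimension, which drops modulo `x`, while `n` stays
  -- fixed.
  induction d generalizing R with
  | zero => exact (not_le.2 hd ringKrullDim_nonneg_of_nontrivial).elim
  | succ d ih =>
    by_cases hm : maximalIdeal R = ⊥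
    · exact ⟨[], IsRegular.nil R R, by simp [hm]⟩
    · obtain ⟨x, hx, hx2, hreg⟩ := exists_isSMulRegular_notMem_sq hm (n + 1)
      have : Nontrivial (R ⧸ Ideal.span {x}) := Ideal.Quotient.nontrivial_iff.2 fun h ↦
        (maximalIdeal.isMaximal R).ne_top
          (top_le_iff.1 (h ▸ (Ideal.span_singleton_le_iff_mem _).2 hx))
      have hsurj : Function.Surjective (algebraMap R (R ⧸ Ideal.span {x})) :=
        Ideal.Quotient.mk_surjective
      have : IsLocalRing (R ⧸ Ideal.span {x}) :=
        IsLocalRing.of_surjective' (Ideal.Quotient.mk _) Ideal.Quotient.mk_surjective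
      have := hasProjectiveDimensionLT_residueField_quotient hx hx2 hreg n
      obtain ⟨rs', h1, h2⟩ := ih (R := R ⧸ Ideal.span {x}) (by
        rw [← ringKrullDim_quotient_span_singleton_succ_eq_ringKrullDim hreg hx] at hd
        exact lt_of_add_lt_add_right (by exact_mod_cast hd))
      obtain ⟨rs, rfl⟩ := List.map_surjective_iff.2 hsurj rs'
      exact ⟨x :: rs, isRegular_cons_of_quotient hreg rs h1 h2⟩

/-- Serre's theorem: a noetherian local ring whose residue field has finite projective dimension is
regular, and its dimension is at most that projective dimension. -/
theorem isRegularLocalRing_and_ringKrullDim_le (n : ℕ)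
    (h : HasProjectiveDimensionLE (ModuleCat.of R (R ⧸ maximalIdeal R)) n) :
    IsRegularLocalRing R ∧ ringKrullDim R ≤ n := by
  obtain ⟨rs, hrs, heq⟩ : ∃ rs : List R, IsRegular R rs ∧ Ideal.ofList rs = maximalIdeal R :=
    have := hasProjectiveDimensionLT_of_ge (ModuleCat.of R (R ⧸ maximalIdeal R)) (n + 1) (n + 2)
      (by omega)
    exists_isRegular_ofList_eq_maximalIdeal n
  have hdim : ringKrullDim R = rs.length := by
    let := Ideal.Quotient.field (maximalIdeal R)
    rw [← ringKrullDim_add_length_eq_ringKrullDim_of_isRegular rs hrs, heq,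
      ringKrullDim_eq_zero_of_field, zero_add]
  constructor
  · classical
    refine IsRegularLocalRing.of_spanFinrank_maximalIdeal_le R ?_
    rw [hdim, Nat.cast_le, ← heq]
    have hset : {r | r ∈ rs} = (rs.toFinset : Set R) := by ext; simp
    calc (Ideal.span {r | r ∈ rs}).spanFinrank ≤ ({r | r ∈ rs} : Set R).ncard :=
          Submodule.spanFinrank_span_le_ncard_of_finite (hset ▸ rs.toFinset.finite_toSet)
      _ ≤ rs.length := by
          rw [hset, Set.ncard_coe_finset]
          exact rs.toFinset_card_le
  -- The quotient by a regular sequence has projective dimension equal to the length; this makes the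
  -- dimension bound sharp.
  · have hpd := ModuleCat.projectiveDimension_quotient_eq_length.{u} rs hrs
    have e : Shrink.{u} (R ⧸ Ideal.ofList rs) ≃ₗ[R] R ⧸ maximalIdeal R :=
      (Shrink.linearEquiv R _).trans (Submodule.quotEquivOfEq _ _ heq)
    rw [hdim, ← hpd, projectiveDimension_eq_of_iso e.toModuleIso]
    exact (projectiveDimension_le_iff _ n).2 h

end Serre

/-! ### Globalization to commutative noetherian rings -/

section Regular

open IsLocalRing

variable {A : Type u} [CommRing A] [IsNoetherianRing A]

omit [IsNoetherianRing A] in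
lemma hasProjectiveDimensionLE_of_isLocalizedModule (S : Submonoid A) (M : ModuleCat.{u} A)
    {N : Type u} [AddCommGroup N] [Module A N] [Module (Localization S) N]
    [IsScalarTower A (Localization S) N] (q : M →ₗ[A] N) [IsLocalizedModule S q] (n : ℕ)
    [HasProjectiveDimensionLE M n] :
    HasProjectiveDimensionLE (ModuleCat.of (Localization S) N) n := by
  have := M.localizedModule_hasProjectiveDimensionLE n S
  exact hasProjectiveDimensionLT_of_linearEquiv
    (LinearEquiv.extendScalarsOfIsLocalization S (Localization S)
      (IsLocalizedModule.linearEquiv S (M.localizedModuleMkLinearMap S) q)) (n + 1)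

omit [IsNoetherianRing A] in
/-- The residue field of the localization of `A` at a prime `p` has projective dimension at most
that of the `A`-module `A ⧸ p`. -/
lemma hasProjectiveDimensionLE_residueField_localization (p : Ideal A) [p.IsPrime] (n : ℕ)
    (h : HasProjectiveDimensionLE (ModuleCat.of A (A ⧸ p)) n) :
    HasProjectiveDimensionLE (ModuleCat.of (Localization.AtPrime p)
      (Localization.AtPrime p ⧸ maximalIdeal (Localization.AtPrime p))) n := by
  have h1 : p.localized' (Localization.AtPrime p) p.primeCompl
      (Algebra.linearMap A (Localization.AtPrime p)) = maximalIdeal (Localization.AtPrime p) := by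
    rw [Ideal.localized'_eq_map, Localization.AtPrime.map_eq_maximalIdeal]
  rw [← h1]
  have : IsLocalizedModule p.primeCompl (p.toLocalizedQuotient' (Localization.AtPrime p) p.primeCompl
    (Algebra.linearMap A (Localization.AtPrime p))) := IsLocalizedModule.toLocalizedQuotient' _ _ _ _
  exact hasProjectiveDimensionLE_of_isLocalizedModule p.primeCompl (ModuleCat.of A (A ⧸ p))
    (p.toLocalizedQuotient' (Localization.AtPrime p) p.primeCompl
      (Algebra.linearMap A (Localization.AtPrime p))) n

/-- A noetherian commutative ring over which every module has projective dimension `≤ n` is regular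
of Krull dimension `≤ n`. -/
theorem isRegularRing_and_ringKrullDim_le (n : ℕ)
    (h : ∀ M : ModuleCat.{u} A, HasProjectiveDimensionLE M n) :
    IsRegularRing A ∧ ringKrullDim A ≤ n := by
  have key (p : Ideal A) [p.IsPrime] := isRegularLocalRing_and_ringKrullDim_le n
    (hasProjectiveDimensionLE_residueField_localization p n (h _))
  refine ⟨isRegularRing_iff.2 fun p _ ↦ (key p).1, ?_⟩
  refine (ringKrullDim_le_iff_height_le _).2 fun p hp ↦ ?_
  rw [← IsLocalization.AtPrime.ringKrullDim_eq_height p (Localization.AtPrime p)]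
  exact (key p).2

end Regular

end StrongReg

theorem mainTheorem7 (r : ℕ) :
    (∀ (A : Type u) [Ring A] [IsNoetherianRing A],
      StrongReg.IsStronglyRegular A r → StrongReg.globalDimension A ≤ (r : WithBot ℕ∞)) ∧
    (∀ (A : Type u) [CommRing A] [IsNoetherianRing A],
      StrongReg.IsStronglyRegular A r →
        IsRegularRing A ∧ ringKrullDim A ≤ (r : WithBot ℕ∞)) :=
  ⟨fun _ _ _ hA ↦ hA.globalDimension_le, fun _ _ _ hA ↦
    StrongReg.isRegularRing_and_ringKrullDim_le r hA.hasProjectiveDimensionLE⟩
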